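/- Let $\mathcal H=L^2(\mathbb R)$ be the Hilbert space of one mode, with photon number basis $|n\rangle$ given by the Hermite functions $\langle q|n\rangle = h_n(q)\,\pi^{-1/4}e^{-q^2/2}$, $h_n(q)=H_n(q)/\sqrt{2^n n!}$, where $H_n$ is the (physicists') Hermite polynomial. Let $a$ be the annihilation operator and let $Q_\theta=(e^{i\theta}a^\dagger+e^{-i\theta}a)/\sqrt2$ be the rotated quadrature, with spectral measure $Q_\theta(X)=e^{i\theta a^\dagger a}\big(\int_X|q\rangle\langle q|\,dq\big)e^{-i\theta a^\dagger a}$ for Borel $X\subseteq\mathbb R$. For an integer $N\ge 1$, $\alpha\in\mathbb R$ and $\eta\in[0,1]$ let $$|N00N\rangle=\tfrac1{\sqrt2}\big(|0N\rangle-e^{iN\alpha}|N0\rangle\big),\qquad \rho_\eta=\eta\,|N00N\rangle\langle N00N|+(1-\eta)\,|00\rangle\langle 00|$$ on $\mathcal H_A\otimes\mathcal H_B$, $\mathcal H_A=\mathcal H_B=\mathcal H$. For angles $\theta_0,\theta_1\in\mathbb R$, Alice's measurements of $Q_{\theta_0},Q_{\theta_1}$ give the state assemblage $\sigma_x(X)=\mathrm{tr}_A[(Q_{\theta_x}(X)\otimes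 1)\rho_\eta]$, $x\in\{0,1\}$. A local hidden state (LHS) model for it is a measure space $(\Lambda,\mu)$, an integrable family of positive trace class operators $\sigma_\lambda$ on $\mathcal H_B$ with $\int\mathrm{tr}[\sigma_\lambda]\,d\mu(\lambda)=1$, and for each $x$ a weak Markov kernel $D_x(X|\lambda)\in[0,1]$ (measurable in $\lambda$, normalised and $\sigma$-additive in $X$ up to null sets), such that $\sigma_x(X)=\int_\Lambda D_x(X|\lambda)\,\sigma_\lambda\,d\mu(\lambda)$ for $x=0,1$ and all Borel $X$. The state $\rho_\eta$ is unsteerable by the pair $Q_{\theta_0},Q_{\theta_1}$ if such a model exists, and $\eta_c$ denotes the supremum of the $\eta\in[0,1]$ for which this is the case. Then for all $N\ge1$, $\alpha$, $\theta_0,\theta_1$, the state $\rho_\eta$ is unsteerable by the pair $Q_{\theta_0},Q_{\theta_1}$ whenever $0\le\eta\le 2/3$; consequently $\eta_c\ge 2/3$. An LHS model for $0\le\eta\le 2/3$ is given explicitly by $\Lambda=\mathbb R^2$ with Lebesgue measure, the deterministic responses $D_x(X|q_0,q_1)=1_X(q_x)$, and the hidden states $$\sigma_{(q_0,q_1)}=\frac{e^{-q_0^2-q_1^2}}{\pi}\Big(\frac\eta2\,|v\rangle\langle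 v|+\big(1-\tfrac{3\eta}2\big)|0\rangle\langle0|\Big),\qquad |v\rangle=|N\rangle-e^{iN\alpha}\big(e^{-iN\theta_0}h_N(q_0)+e^{-iN\theta_1}h_N(q_1)\big)|0\rangle .$$ -/

import Mathlib

open MeasureTheory Polynomial
open scoped ENNReal InnerProductSpace FourierTransform Nat TensorProduct

noncomputable section

namespace NoonSteering

lemma integrable_exp_abs (c : ℝ) :
    Integrable (fun q : ℝ => Real.exp (c * |q|) * Real.exp (-q ^ 2)) := by
  have h := (integrable_exp_neg_mul_sq (b := 1 / 2) (by norm_num)).const_mul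
    (Real.exp (c ^ 2 / 2))
  refine h.mono' (by fun_prop) (.of_forall fun q => ?_)
  rw [Real.norm_of_nonneg (by positivity), ← Real.exp_add, ← Real.exp_add]
  apply Real.exp_le_exp.2
  nlinarith [sq_nonneg (c - |q|), sq_abs q]

lemma memLp_exp_abs (c : ℝ) :
    MemLp (fun q : ℝ => Real.exp (c * |q|) * Real.exp (-q ^ 2 / 2)) 2 := by
  rw [memLp_two_iff_integrable_sq (by fun_prop)]
  refine (integrable_exp_abs (2 * c)).congr (.of_forall fun q => ?_)
  simp only [← Real.exp_add, ← Real.exp_nat_mul]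
  congr 1
  push_cast
  ring

lemma exists_abs_eval_le (p : ℝ[X]) :
    ∃ C, ∃ c, ∀ q : ℝ, |p.eval (√2 * q)| ≤ C * Real.exp (c * |q|) := by
  induction p using Polynomial.induction_on' with
  | add p r hp hr =>
    obtain ⟨C, c, h⟩ := hp
    obtain ⟨D, d, k⟩ := hr
    refine ⟨|C| + |D|, |c| + |d|, fun q => ?_⟩
    rw [eval_add]
    have h1 : C * Real.exp (c * |q|) ≤ |C| * Real.exp ((|c| + |d|) * |q|) := by
      gcongr
      · exact le_abs_self C
      · linarith [le_abs_self c, abs_nonneg d]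
    have h2 : D * Real.exp (d * |q|) ≤ |D| * Real.exp ((|c| + |d|) * |q|) := by
      gcongr
      · exact le_abs_self D
      · linarith [le_abs_self d, abs_nonneg c]
    linarith [abs_add_le (p.eval (√2 * q)) (r.eval (√2 * q)), h q, k q]
  | monomial n a =>
    refine ⟨|a| * n !, √2, fun q => ?_⟩
    rw [eval_monomial, abs_mul, abs_pow, abs_mul, abs_of_nonneg (Real.sqrt_nonneg 2), mul_assoc]
    gcongr
    have := Real.pow_div_factorial_le_exp (√2 * |q|) (by positivity) n
    rwa [div_le_iff₀' (by positivity)] at this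

lemma integrable_eval (p : ℝ[X]) :
    Integrable (fun q : ℝ => p.eval (√2 * q) * Real.exp (-q ^ 2)) := by
  obtain ⟨C, c, h⟩ := exists_abs_eval_le p
  refine ((integrable_exp_abs c).const_mul C).mono'
    (by have := p.continuous; fun_prop) (.of_forall fun q => ?_)
  rw [norm_mul, Real.norm_eq_abs, Real.norm_of_nonneg (Real.exp_pos _).le, ← mul_assoc]
  gcongr
  exact h q

lemma memLp_eval (p : ℝ[X]) :
    MemLp (fun q : ℝ => p.eval (√2 * q) * Real.exp (-q ^ 2 / 2)) 2 := by
  obtain ⟨C, c, h⟩ := exists_abs_eval_le p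
  refine ((memLp_exp_abs c).const_mul C).mono'
    (by have := p.continuous; fun_prop) (.of_forall fun q => ?_)
  rw [norm_mul, Real.norm_eq_abs, Real.norm_of_nonneg (Real.exp_pos _).le, ← mul_assoc]
  gcongr
  exact h q

/-- Integration of a polynomial in `√2 q` against the Gaussian weight `exp (-q²)`. -/
def gaussInt (p : ℝ[X]) : ℝ := ∫ q : ℝ, p.eval (√2 * q) * Real.exp (-q ^ 2)

lemma gaussInt_sub (p r : ℝ[X]) : gaussInt (p - r) = gaussInt p - gaussInt r := by
  unfold gaussInt
  rw [← integral_sub (integrable_eval p) (integrable_eval r)]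
  simp [sub_mul]

lemma gaussInt_by_parts (p : ℝ[X]) : gaussInt (X * p - derivative p) = 0 := by
  have hd : ∀ q : ℝ, HasDerivAt (fun q : ℝ => p.eval (√2 * q) * Real.exp (-q ^ 2))
      (-√2 * ((X * p - derivative p).eval (√2 * q) * Real.exp (-q ^ 2))) q := by
    intro q
    have h0 : HasDerivAt (fun q : ℝ => √2 * q) √2 q := by
      simpa using (hasDerivAt_id q).const_mul √2
    have h1 : HasDerivAt (fun q : ℝ => p.eval (√2 * q)) ((derivative p).eval (√2 * q) * √2) q :=
      (p.hasDerivAt (√2 * q)).comp q h0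
    have h2 : HasDerivAt (fun q : ℝ => Real.exp (-q ^ 2)) (Real.exp (-q ^ 2) * (-(2 * q))) q := by
      simpa using ((hasDerivAt_pow 2 q).neg).exp
    refine (h1.mul h2).congr_deriv ?_
    have : √2 * √2 = 2 := Real.mul_self_sqrt (by norm_num)
    simp only [eval_sub, eval_mul, eval_X]
    linear_combination (q * p.eval (√2 * q) * Real.exp (-q ^ 2)) * this
  have h := integral_eq_zero_of_hasDerivAt_of_integrable hd
    ((integrable_eval _).const_mul _) (integrable_eval p)
  rw [integral_const_mul] at h
  exact (mul_eq_zero.1 h).resolve_left (by simp)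

/-- The (probabilists') Hermite polynomial with real coefficients. -/
def realHermite (n : ℕ) : ℝ[X] := (hermite n).map (Int.castRingHom ℝ)

lemma gaussInt_hermite_mul (m : ℕ) (r : ℝ[X]) :
    gaussInt (realHermite m * r) = gaussInt (derivative^[m] r) := by
  induction m generalizing r with
  | zero => simp [realHermite]
  | succ m ih =>
    have h := gaussInt_by_parts (realHermite m * r)
    have e : X * (realHermite m * r) - derivative (realHermite m * r)
        = realHermite (m + 1) * r - realHermite m * derivative r := by
      simp only [realHermite, hermite_succ, Polynomial.map_sub, Polynomial.map_mul, map_X,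
        derivative_mul, derivative_map]
      ring
    rw [e, gaussInt_sub, sub_eq_zero] at h
    rw [h, ih, Function.iterate_succ_apply]

lemma natDegree_realHermite (n : ℕ) : (realHermite n).natDegree = n := by
  rw [realHermite, (hermite_monic n).natDegree_map, natDegree_hermite]

lemma monic_realHermite (n : ℕ) : (realHermite n).Monic := (hermite_monic n).map _

lemma gaussInt_one : gaussInt 1 = √Real.pi := by
  simpa [gaussInt] using integral_gaussian 1

lemma gaussInt_hermite_hermite_of_lt {m n : ℕ} (h : n < m) :
    gaussInt (realHermite m * realHermite n) = 0 := by
  rw [gaussInt_hermite_mul, iterate_derivative_eq_zero (by rwa [natDegree_realHermite])]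
  simp [gaussInt]

lemma gaussInt_hermite_self (n : ℕ) :
    gaussInt (realHermite n * realHermite n) = n ! * √Real.pi := by
  have h : derivative^[n] (realHermite n) = C (n ! : ℝ) := by
    rw [eq_C_of_natDegree_le_zero (p := derivative^[n] (realHermite n))
      ((natDegree_iterate_derivative _ _).trans (by rw [natDegree_realHermite]; simp))]
    congr 1
    rw [coeff_iterate_derivative, zero_add, Nat.descFactorial_self]
    have := monic_realHermite n
    rw [Monic, leadingCoeff, natDegree_realHermite] at this
    simp [this]
  rw [gaussInt_hermite_mul, h, ← gaussInt_one]
  simp [gaussInt, integral_const_mul]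

/-- The function `h_n(q) = H_n(q) / √(2ⁿ n!)`, with `H_n` the physicists' Hermite polynomial.
In terms of Mathlib's (probabilists') polynomial, `H_n(q) = 2^(n/2) He_n(√2 q)`. -/
def hermiteRatio (n : ℕ) (q : ℝ) : ℝ := aeval (√2 * q) (hermite n) / √(n ! : ℝ)

/-- The Hermite function `⟨q|n⟩ = H_n(q) / √(2ⁿ n!) · π^(-1/4) · exp (-q²/2)`. -/
def hermiteFun (n : ℕ) (q : ℝ) : ℝ := hermiteRatio n q * (Real.exp (-q ^ 2 / 2) / √(√Real.pi))

lemma hermiteFun_eq (n : ℕ) (q : ℝ) : hermiteFun n q =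
    (√(n ! : ℝ) * √(√Real.pi))⁻¹ * ((realHermite n).eval (√2 * q) * Real.exp (-q ^ 2 / 2)) := by
  have : aeval (√2 * q) (hermite n) = (realHermite n).eval (√2 * q) := by
    rw [realHermite, eval_map, aeval_def]; rfl
  rw [hermiteFun, hermiteRatio, this]
  field_simp

lemma memLp_hermiteFun (n : ℕ) : MemLp (fun q => (hermiteFun n q : ℂ)) 2 := by
  have : MemLp (hermiteFun n) 2 := by
    rw [funext (hermiteFun_eq n)]
    exact (memLp_eval _).const_mul _
  exact this.ofReal

/-- The Hilbert space of one mode, in the position (wave function) representation. -/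
abbrev Mode : Type := Lp ℂ 2 (volume : Measure ℝ)

/-- The number state `|n⟩` as a wave function. -/
def numberState (n : ℕ) : Mode := (memLp_hermiteFun n).toLp

lemma integral_hermiteFun_mul (m n : ℕ) : ∫ q, hermiteFun m q * hermiteFun n q =
    (√(m ! : ℝ) * √(√Real.pi))⁻¹ * (√(n ! : ℝ) * √(√Real.pi))⁻¹ *
      gaussInt (realHermite m * realHermite n) := by
  rw [gaussInt, ← integral_const_mul]
  congr 1
  ext q
  have : Real.exp (-q ^ 2) = Real.exp (-q ^ 2 / 2) * Real.exp (-q ^ 2 / 2) := by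
    rw [← Real.exp_add]; ring_nf
  rw [hermiteFun_eq, hermiteFun_eq, this, eval_mul]
  ring

lemma inner_numberState (m n : ℕ) : ⟪numberState m, numberState n⟫_ℂ =
    ((∫ q, hermiteFun m q * hermiteFun n q : ℝ) : ℂ) := by
  rw [L2.inner_def, ← integral_complex_ofReal]
  apply integral_congr_ae
  filter_upwards [(memLp_hermiteFun m).coeFn_toLp, (memLp_hermiteFun n).coeFn_toLp] with q h1 h2
  rw [numberState, numberState, h1, h2]
  simp [mul_comm]

lemma orthonormal_numberState : Orthonormal ℂ numberState := by
  rw [orthonormal_iff_ite]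
  intro m n
  rw [inner_numberState, integral_hermiteFun_mul]
  rcases lt_trichotomy m n with h | h | h
  · rw [mul_comm (realHermite m), gaussInt_hermite_hermite_of_lt h]
    simp [h.ne]
  · subst h
    rw [gaussInt_hermite_self, if_pos rfl]
    have h1 : √(m ! : ℝ) * √(m ! : ℝ) = m ! := Real.mul_self_sqrt (by positivity)
    have h2 : √(√Real.pi) * √(√Real.pi) = √Real.pi := Real.mul_self_sqrt (by positivity)
    have h3 : (m ! : ℝ) * √Real.pi ≠ 0 := by positivity
    norm_cast
    rw [← mul_inv, mul_mul_mul_comm, h1, h2]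
    exact inv_mul_cancel₀ h3
  · rw [gaussInt_hermite_hermite_of_lt h]
    simp [h.ne']

lemma integrable_exp_mul (c : ℝ) (f : Mode) :
    Integrable (fun q : ℝ => ((Real.exp (c * |q|) * Real.exp (-q ^ 2 / 2) : ℝ) : ℂ) * f q) :=
  MemLp.integrable_mul (memLp_exp_abs c).ofReal (Lp.memLp f)

lemma integrable_eval_mul (p : ℝ[X]) (f : Mode) :
    Integrable (fun q : ℝ => ((p.eval (√2 * q) * Real.exp (-q ^ 2 / 2) : ℝ) : ℂ) * f q) :=
  MemLp.integrable_mul (memLp_eval p).ofReal (Lp.memLp f)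

lemma integral_eval_mul_eq_zero (f : Mode) (hf : ∀ n, ⟪numberState n, f⟫_ℂ = 0) (p : ℝ[X]) :
    ∫ q : ℝ, ((p.eval (√2 * q) * Real.exp (-q ^ 2 / 2) : ℝ) : ℂ) * f q = 0 := by
  let S : Polynomial.Sequence ℝ := ⟨realHermite, fun i => by
    rw [degree_eq_natDegree (monic_realHermite i).ne_zero, natDegree_realHermite]⟩
  have hS : p ∈ Submodule.span ℝ (Set.range realHermite) := by
    have := S.span fun i => by
      change IsUnit (realHermite i).leadingCoeff
      rw [monic_realHermite i]
      exact isUnit_one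
    change p ∈ Submodule.span ℝ (Set.range S)
    rw [this]
    trivial
  induction hS using Submodule.span_induction with
  | mem x hx =>
    obtain ⟨n, rfl⟩ := hx
    have h := hf n
    rw [L2.inner_def] at h
    have h' : ∫ q : ℝ, (((√(n ! : ℝ) * √(√Real.pi))⁻¹ : ℝ) : ℂ) *
        ((((realHermite n).eval (√2 * q) * Real.exp (-q ^ 2 / 2) : ℝ) : ℂ) * f q) = 0 := by
      rw [← h]
      apply integral_congr_ae
      filter_upwards [(memLp_hermiteFun n).coeFn_toLp] with q h1
      rw [numberState, h1, hermiteFun_eq]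
      rw [RCLike.inner_apply, Complex.conj_ofReal]
      push_cast
      ring
    rw [integral_const_mul] at h'
    refine (mul_eq_zero.1 h').resolve_left ?_
    have : (√(n ! : ℝ) * √(√Real.pi))⁻¹ ≠ 0 := by positivity
    exact_mod_cast this
  | zero => simp
  | add x y _ _ hx hy =>
    have := integral_add (integrable_eval_mul x f) (integrable_eval_mul y f)
    rw [hx, hy, add_zero] at this
    rw [← this]
    congr 1
    ext q
    simp only [eval_add]
    push_cast
    ring
  | smul a x _ hx =>
    have := integral_const_mul (μ := (volume : Measure ℝ)) (a : ℂ)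
      (fun q : ℝ => ((x.eval (√2 * q) * Real.exp (-q ^ 2 / 2) : ℝ) : ℂ) * f q)
    rw [hx, mul_zero] at this
    rw [← this]
    congr 1
    ext q
    simp only [eval_smul, smul_eq_mul]
    push_cast
    ring

lemma fourier_eq_zero (f : Mode) (hf : ∀ n, ⟪numberState n, f⟫_ℂ = 0) (w : ℝ) :
    𝓕 (fun q : ℝ => ((Real.exp (-q ^ 2 / 2) : ℝ) : ℂ) * f q) w = 0 := by
  rw [Real.fourier_real_eq_integral_exp_smul]
  set c : ℝ := 2 * Real.pi * |w| with hc
  have hfm : AEStronglyMeasurable f volume := (Lp.memLp f).1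
  have key := hasSum_integral_of_dominated_convergence (μ := (volume : Measure ℝ))
    (F := fun (n : ℕ) (q : ℝ) => ((((-2 * Real.pi * q * w : ℝ) : ℂ) * Complex.I) ^ n / n !) *
      (((Real.exp (-q ^ 2 / 2) : ℝ) : ℂ) * f q))
    (f := fun q : ℝ => Complex.exp (((-2 * Real.pi * q * w : ℝ) : ℂ) * Complex.I) •
      (((Real.exp (-q ^ 2 / 2) : ℝ) : ℂ) * f q))
    (fun n q => ((c * |q|) ^ n / n !) * ‖((Real.exp (-q ^ 2 / 2) : ℝ) : ℂ) * f q‖)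
    ?_ ?_ ?_ ?_ ?_
  · refine key.unique ?_
    convert hasSum_zero with n
    have h0 := integral_eval_mul_eq_zero f hf (X ^ n)
    have h1 : ∀ q : ℝ, ((((-2 * Real.pi * q * w : ℝ) : ℂ) * Complex.I) ^ n / n !) *
        (((Real.exp (-q ^ 2 / 2) : ℝ) : ℂ) * f q) =
        ((((-2 * Real.pi * w / √2 : ℝ) : ℂ) * Complex.I) ^ n / n !) *
        (((((X ^ n : ℝ[X]).eval (√2 * q) * Real.exp (-q ^ 2 / 2) : ℝ) : ℂ)) * f q) := by
      intro q
      have h2 : (-2 * Real.pi * q * w : ℝ) = (-2 * Real.pi * w / √2) * (√2 * q) := by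
        field_simp
      rw [h2, eval_pow, eval_X, mul_pow, Complex.ofReal_mul, mul_pow, mul_pow]
      push_cast
      ring
    simp_rw [h1]
    rw [integral_const_mul, h0, mul_zero]
  · intro n
    fun_prop
  · intro n
    refine .of_forall fun q => le_of_eq ?_
    rw [norm_mul, norm_div, norm_pow, norm_mul, Complex.norm_I, mul_one, Complex.norm_real,
      Complex.norm_natCast, Real.norm_eq_abs, hc]
    congr 3
    rw [abs_mul, abs_mul, abs_mul, abs_of_pos Real.pi_pos]
    norm_num
    ring
  · exact .of_forall fun q => (Real.summable_pow_div_factorial _).mul_right _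
  · refine (integrable_exp_mul c f).norm.congr (.of_forall fun q => ?_)
    simp only
    rw [tsum_mul_right, ← congrFun NormedSpace.exp_eq_tsum_div (c * |q|), ← Real.exp_eq_exp_ℝ, Complex.ofReal_mul, mul_assoc, norm_mul,
      Complex.norm_real, Real.norm_of_nonneg (Real.exp_pos _).le]
  · refine .of_forall fun q => ?_
    rw [smul_eq_mul]
    have := NormedSpace.expSeries_div_hasSum_exp (((-2 * Real.pi * q * w : ℝ) : ℂ) * Complex.I)
    rw [← Complex.exp_eq_exp_ℂ] at this
    exact this.mul_right _

lemma span_numberState_orthogonal : (Submodule.span ℂ (Set.range numberState))ᗮ = ⊥ := by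
  rw [eq_bot_iff]
  intro f hf
  have hf' : ∀ n, ⟪numberState n, f⟫_ℂ = 0 := fun n =>
    (Submodule.mem_orthogonal _ _).1 hf _ (Submodule.subset_span ⟨n, rfl⟩)
  have hint : Integrable (fun q : ℝ => ((Real.exp (-q ^ 2 / 2) : ℝ) : ℂ) * f q) := by
    simpa using integrable_exp_mul 0 f
  have hz : ∀ᵐ q : ℝ, ((Real.exp (-q ^ 2 / 2) : ℝ) : ℂ) * f q = 0 := by
    apply ae_eq_zero_of_integral_contDiff_smul_eq_zero hint.locallyIntegrable
    intro g hg hgc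
    have hg₁ : HasCompactSupport (Complex.ofRealCLM ∘ g) := hgc.comp_left rfl
    have hg₂ : ContDiff ℝ (⊤ : ℕ∞) (Complex.ofRealCLM ∘ g) := Complex.ofRealCLM.contDiff.comp hg
    let ψ : SchwartzMap ℝ ℂ := hg₁.toSchwartzMap hg₂
    have h := VectorFourier.integral_fourierIntegral_smul_eq_flip (L := innerₗ ℝ)
      (μ := volume) (ν := volume)
      Real.continuous_fourierChar continuous_inner (𝓕⁻ ψ : SchwartzMap ℝ ℂ).integrable hint
    have e1 : ∀ ξ, VectorFourier.fourierIntegral Real.fourierChar volume (innerₗ ℝ)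
        (𝓕⁻ ψ : SchwartzMap ℝ ℂ) ξ
        = ψ ξ := by
      intro ξ
      change 𝓕 (⇑(𝓕⁻ ψ : SchwartzMap ℝ ℂ)) ξ = ψ ξ
      rw [← SchwartzMap.fourier_coe, FourierTransform.fourier_fourierInv_eq]
    have e2 : ∀ x, VectorFourier.fourierIntegral Real.fourierChar volume (innerₗ ℝ).flip
        (fun q : ℝ => ((Real.exp (-q ^ 2 / 2) : ℝ) : ℂ) * f q) x = 0 := by
      intro x
      rw [flip_innerₗ]
      exact fourier_eq_zero f hf' x
    simp only [e1, e2, smul_zero, integral_zero] at h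
    rw [← h]
    rfl
  rw [Submodule.mem_bot, Lp.eq_zero_iff_ae_eq_zero]
  filter_upwards [hz] with q hq
  simpa using hq

/-- The photon number basis `(|n⟩)` of one mode. -/
def numberBasis : HilbertBasis ℕ ℂ Mode :=
  HilbertBasis.mkOfOrthogonalEqBot orthonormal_numberState span_numberState_orthogonal

/-! ### Bipartite systems, state assemblages and local hidden state models -/

/-- The Hilbert space tensor product `H_A ⊗ H_B` (completed algebraic tensor product). -/
abbrev HilbertTensor (HA HB : Type) [NormedAddCommGroup HA] [InnerProductSpace ℂ HA]
    [NormedAddCommGroup HB] [InnerProductSpace ℂ HB] : Type :=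
  UniformSpace.Completion (HA ⊗[ℂ] HB)

section Bipartite

variable {HA HB : Type} [NormedAddCommGroup HA] [InnerProductSpace ℂ HA]
  [NormedAddCommGroup HB] [InnerProductSpace ℂ HB]

/-- The bounded map `v ↦ u ⊗ v` from `H_B` to `H_A ⊗ H_B`. -/
def tensorWith (u : HA) : HB →L[ℂ] HilbertTensor HA HB :=
  (UniformSpace.Completion.toComplL (𝕜 := ℂ) (E := HA ⊗[ℂ] HB)).comp
    (TensorProduct.mkL ℂ HA HB u)

/-- The operator `A ⊗ 1` on `H_A ⊗ H_B`, for a bounded operator `A` on `H_A`. -/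
def ampliation (A : HA →L[ℂ] HA) : HilbertTensor HA HB →L[ℂ] HilbertTensor HA HB :=
  (A.rTensor HB).completion

/-- The partial trace over `H_A`, `tr_A[T] = ∑ₖ (⟨k| ⊗ 1) T (|k⟩ ⊗ 1)`, computed in an orthonormal
basis `(|k⟩)` of `H_A`. The series converges absolutely for each trace class operator `T`. -/
def partialTrace [CompleteSpace HB] {κ : Type} (b : HilbertBasis κ ℂ HA)
    (T : HilbertTensor HA HB →L[ℂ] HilbertTensor HA HB) : HB →L[ℂ] HB :=
  ∑' k, (ContinuousLinearMap.adjoint (tensorWith (HB := HB) (b k))).comp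
    (T.comp (tensorWith (b k)))

/-- The state assemblage `σ_x(X) = tr_A[(A_x(X) ⊗ 1) ρ]` prepared for Bob when Alice measures the
observables `A_x` on the bipartite state `ρ`. -/
def stateAssemblage [CompleteSpace HB] {κ ι 𝒜 : Type} (b : HilbertBasis κ ℂ HA)
    (ρ : HilbertTensor HA HB →L[ℂ] HilbertTensor HA HB) (A : ι → Set 𝒜 → (HA →L[ℂ] HA)) :
    ι → Set 𝒜 → (HB →L[ℂ] HB) :=
  fun x X => partialTrace b ((ampliation (A x X)).comp ρ)

/-- The trace `∑ₖ ⟨k|T|k⟩ ∈ [0, ∞]` of a positive operator `T`. -/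
def posTrace {κ : Type} (b : HilbertBasis κ ℂ HB) (T : HB →L[ℂ] HB) : ℝ≥0∞ :=
  ∑' k, ENNReal.ofReal (⟪b k, T (b k)⟫_ℂ).re

/-- A weak Markov kernel from `(Λ, μ)` to the outcome space `𝒜`: a function `D(X | l) ∈ [0, 1]`
that is measurable in `l` and, for `μ`-almost every `l`, normalised and `σ`-additive in `X` (the
exceptional null set may depend on the sequence of sets). -/
structure IsWeakMarkovKernel {𝒜 Λ : Type} [MeasurableSpace 𝒜] [MeasurableSpace Λ]
    (μ : Measure Λ) (D : Set 𝒜 → Λ → ℝ) : Prop where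
  measurable : ∀ X, MeasurableSet X → Measurable (D X)
  mem_Icc : ∀ X, MeasurableSet X → ∀ l, D X l ∈ Set.Icc (0 : ℝ) 1
  normalised : ∀ᵐ l ∂μ, D Set.univ l = 1
  additive : ∀ X : ℕ → Set 𝒜, (∀ i, MeasurableSet (X i)) →
    Pairwise (fun i j => Disjoint (X i) (X j)) →
    ∀ᵐ l ∂μ, HasSum (fun i => D (X i) l) (D (⋃ i, X i) l)

/-- `(σ_l)`, together with the response functions `D_x(X | l)`, is a local hidden state model with
hidden variable space `(Λ, μ)` for the assemblage `S`: the `σ_l` are positive trace class operators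
depending on `l` in an integrable way, with `∫ tr[σ_l] dμ(l) = 1`, each `D_x` is a weak Markov
kernel, and `S_x(X) = ∫ D_x(X | l) σ_l dμ(l)` for each setting `x` and each measurable `X`.
The hidden states are positive with integrable trace, so that measurability and Bochner
integrability in operator norm and in trace norm are the same, with the same integral. -/
structure IsLHSModel {κ ι 𝒜 Λ : Type} [MeasurableSpace 𝒜] [MeasurableSpace Λ]
    (b : HilbertBasis κ ℂ HB) (S : ι → Set 𝒜 → (HB →L[ℂ] HB))
    (μ : Measure Λ) (σ : Λ → (HB →L[ℂ] HB)) (D : ι → Set 𝒜 → Λ → ℝ) : Prop where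
  positive : ∀ l, (σ l).IsPositive
  traceClass : ∀ l, posTrace b (σ l) < ∞
  integrable : Integrable σ μ
  normalised : ∫⁻ l, posTrace b (σ l) ∂μ = 1
  kernel : ∀ x, IsWeakMarkovKernel μ (D x)
  decomposition : ∀ x X, MeasurableSet X → S x X = ∫ l, D x X l • σ l ∂μ

/-- The state `ρ` is unsteerable by the measurement assemblage `A` of Alice: the state assemblage
that it produces has a local hidden state model. -/
def IsUnsteerable [CompleteSpace HB] {κ κ' ι 𝒜 : Type} [MeasurableSpace 𝒜]
    (bA : HilbertBasis κ ℂ HA) (bB : HilbertBasis κ' ℂ HB)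
    (ρ : HilbertTensor HA HB →L[ℂ] HilbertTensor HA HB) (A : ι → Set 𝒜 → (HA →L[ℂ] HA)) : Prop :=
  ∃ (Λ : Type) (_ : MeasurableSpace Λ) (μ : Measure Λ) (_ : SigmaFinite μ)
    (σ : Λ → (HB →L[ℂ] HB)) (D : ι → Set 𝒜 → Λ → ℝ),
    IsLHSModel bB (stateAssemblage bA ρ A) μ σ D

end Bipartite

/-! ### Rotated quadratures -/

/-- Multiplication of a wave function by the indicator function of a measurable set. -/
def indicatorMul (X : Set ℝ) (hX : MeasurableSet X) : Mode →L[ℂ] Mode :=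
  LinearMap.mkContinuous
    { toFun := fun f => ((Lp.memLp f).indicator hX).toLp
      map_add' := fun f g => by
        ext1
        filter_upwards [((Lp.memLp (f + g)).indicator hX).coeFn_toLp,
          ((Lp.memLp f).indicator hX).coeFn_toLp, ((Lp.memLp g).indicator hX).coeFn_toLp,
          Lp.coeFn_add f g, Lp.coeFn_add ((Lp.memLp f).indicator hX).toLp
            ((Lp.memLp g).indicator hX).toLp] with q h1 h2 h3 h4 h5
        rw [h1, h5, Pi.add_apply, h2, h3]
        by_cases hq : q ∈ X
        · rw [Set.indicator_of_mem hq, Set.indicator_of_mem hq, Set.indicator_of_mem hq, h4,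
            Pi.add_apply]
        · rw [Set.indicator_of_notMem hq, Set.indicator_of_notMem hq, Set.indicator_of_notMem hq,
            add_zero]
      map_smul' := fun c f => by
        ext1
        filter_upwards [((Lp.memLp (c • f)).indicator hX).coeFn_toLp,
          ((Lp.memLp f).indicator hX).coeFn_toLp, Lp.coeFn_smul c f,
          Lp.coeFn_smul c ((Lp.memLp f).indicator hX).toLp] with q h1 h2 h3 h4
        rw [h1, RingHom.id_apply, h4, Pi.smul_apply, h2]
        by_cases hq : q ∈ X
        · rw [Set.indicator_of_mem hq, Set.indicator_of_mem hq, h3, Pi.smul_apply]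
        · rw [Set.indicator_of_notMem hq, Set.indicator_of_notMem hq, smul_zero] }
    1 fun f => by
      rw [one_mul]
      change ‖((Lp.memLp f).indicator hX).toLp‖ ≤ ‖f‖
      rw [Lp.norm_toLp, Lp.norm_def]
      exact ENNReal.toReal_mono (Lp.eLpNorm_ne_top f) (eLpNorm_indicator_le f)

open Classical in
/-- The spectral measure `X ↦ ∫_X |q⟩⟨q| dq` of the position quadrature `Q = (a† + a)/√2` on
measurable sets (with value `0` on the others). -/
def positionPVM (X : Set ℝ) : Mode →L[ℂ] Mode :=
  if hX : MeasurableSet X then indicatorMul X hX else 0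

lemma norm_phase (θ : ℝ) (n : ℕ) (z : ℂ) : ‖Complex.exp (Complex.I * n * θ) * z‖ = ‖z‖ := by
  rw [norm_mul, mul_assoc, ← Complex.ofReal_natCast, ← Complex.ofReal_mul, mul_comm Complex.I,
    Complex.norm_exp_ofReal_mul_I, one_mul]

/-- The diagonal isometry `(c_n) ↦ (exp (i n θ) c_n)` of `ℓ²(ℕ)`. -/
def phaseDiagonal (θ : ℝ) : lp (fun _ : ℕ => ℂ) 2 →ₗᵢ[ℂ] lp (fun _ : ℕ => ℂ) 2 where
  toFun f := ⟨fun n => Complex.exp (Complex.I * n * θ) * f n,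
    (lp.memℓp f).mono' fun n => (norm_phase θ n (f n)).le⟩
  map_add' f g := by
    ext n
    exact mul_add _ _ _
  map_smul' c f := by
    ext n
    exact mul_left_comm _ _ _
  norm_map' f := by
    rw [lp.norm_eq_tsum_rpow (by norm_num), lp.norm_eq_tsum_rpow (by norm_num)]
    refine congrArg (fun t : ℝ => t ^ (1 / (2 : ℝ≥0∞).toReal)) (tsum_congr fun n => ?_)
    exact congrArg (fun t : ℝ => t ^ (2 : ℝ≥0∞).toReal) (norm_phase θ n (f n))

/-- The phase rotation `exp (i θ a†a)`, i.e. the operator with `|n⟩ ↦ exp (i n θ) |n⟩`. -/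
def phaseRotation (θ : ℝ) : Mode →L[ℂ] Mode :=
  (numberBasis.repr.symm.toLinearIsometry.comp
    ((phaseDiagonal θ).comp numberBasis.repr.toLinearIsometry)).toContinuousLinearMap

/-- The spectral measure `X ↦ Q_θ(X) = exp (i θ a†a) (∫_X |q⟩⟨q| dq) exp (-i θ a†a)` of the rotated
quadrature `Q_θ = (exp (i θ) a† + exp (-i θ) a)/√2`. -/
def quadraturePVM (θ : ℝ) (X : Set ℝ) : Mode →L[ℂ] Mode :=
  (phaseRotation θ).comp ((positionPVM X).comp (phaseRotation (-θ)))

/-! ### Noisy NOON states -/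

/-- The product number state `|n m⟩` of two modes. -/
def ket (n m : ℕ) : HilbertTensor Mode Mode := tensorWith (numberBasis n) (numberBasis m)

/-- The NOON state `(|0N⟩ - exp (i N α) |N0⟩)/√2`. -/
def noonVec (N : ℕ) (α : ℝ) : HilbertTensor Mode Mode :=
  ((1 / √2 : ℝ) : ℂ) • (ket 0 N - Complex.exp (Complex.I * N * α) • ket N 0)

/-- The noisy NOON state `ρ_η = η |N00N⟩⟨N00N| + (1 - η) |00⟩⟨00|`. -/
def noisyNoon (N : ℕ) (α η : ℝ) : HilbertTensor Mode Mode →L[ℂ] HilbertTensor Mode Mode :=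
  (η : ℂ) • InnerProductSpace.rankOne ℂ (noonVec N α) (noonVec N α) +
    ((1 - η : ℝ) : ℂ) • InnerProductSpace.rankOne ℂ (ket 0 0) (ket 0 0)

/-- The state `ρ_η` is unsteerable by the rotated quadratures with angles `θ 0` and `θ 1`. -/
def NoonUnsteerable (N : ℕ) (α η : ℝ) (θ : Fin 2 → ℝ) : Prop :=
  IsUnsteerable numberBasis numberBasis (noisyNoon N α η) (fun x => quadraturePVM (θ x))

/-- The steerability threshold `η_c` of the noisy NOON state, for given angles of the quadratures:
the supremum of the `η ∈ [0, 1]` for which `ρ_η` is unsteerable. -/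
def steeringThreshold (N : ℕ) (α : ℝ) (θ : Fin 2 → ℝ) : ℝ :=
  sSup {η : ℝ | η ∈ Set.Icc (0 : ℝ) 1 ∧ NoonUnsteerable N α η θ}

/-- The (unnormalised) vector `|N⟩ - exp (i N α) ∑ₓ exp (-i N θ_x) h_N(q_x) |0⟩` of Bob's mode. -/
def hiddenVec (N : ℕ) (α : ℝ) (θ q : Fin 2 → ℝ) : Mode :=
  numberBasis N - (Complex.exp (Complex.I * N * α) *
    ∑ x, Complex.exp (-(Complex.I * N * θ x)) * (hermiteRatio N (q x) : ℂ)) • numberBasis 0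

/-- The hidden state `σ_q = (∏ₓ exp (-q_x²)/√π) (η/2 |v_q⟩⟨v_q| + (1 - 3η/2) |0⟩⟨0|)` with
`v_q = hiddenVec N α θ q`, for the hidden variable `q = (q_0, q_1) ∈ ℝ²`. -/
def hiddenState (N : ℕ) (α η : ℝ) (θ q : Fin 2 → ℝ) : Mode →L[ℂ] Mode :=
  ((∏ x, Real.exp (-q x ^ 2) / √Real.pi : ℝ) : ℂ) •
    (((η / 2 : ℝ) : ℂ) • InnerProductSpace.rankOne ℂ (hiddenVec N α θ q) (hiddenVec N α θ q) +
      ((1 - 3 * η / 2 : ℝ) : ℂ) • InnerProductSpace.rankOne ℂ (numberBasis 0) (numberBasis 0))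

/-- The deterministic response `D_x(X | q) = 1_X(q_x)`. -/
def deterministicResponse (x : Fin 2) (X : Set ℝ) (q : Fin 2 → ℝ) : ℝ :=
  X.indicator (fun _ => 1) (q x)

end NoonSteering

end

open scoped ComplexConjugate ComplexOrder

namespace NoonSteering

open InnerProductSpace

/-! ### Product vectors in the Hilbert space tensor product -/

section Bipartite

variable {HA HB : Type} [NormedAddCommGroup HA] [InnerProductSpace ℂ HA]
  [NormedAddCommGroup HB] [InnerProductSpace ℂ HB]

/-! Given outcome `q_x`, the NOON part of Bob's state is, up to the Gaussian weight and a factor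
`1/√2`, the vector `|N⟩ - e^{iNα} e^{-iNθ_x} h_N(q_x) |0⟩`. The hidden vector `v` carries the `|0⟩`
contributions of both settings at once. Under the weight `e^{-q²}/√π`, `h_N` has mean zero and
second moment one, because the Hermite functions are orthonormal and `N ≠ 0`. Integrating out the
other outcome `q_y` therefore kills every term linear in `h_N(q_y)`, and its square leaves exactly
one surplus term `(η/2)|0⟩⟨0|`. The coefficient `1 - 3η/2` of the noise is chosen so that the
surplus raises it to the required `1 - η`; its nonnegativity is the bound `η ≤ 2/3`.

Everything lives in the span of `|0⟩` and `|N⟩`, so the decomposition is an identity of four matrix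
coefficients. `stateAssemblage_noisyNoon` with `inner_quadraturePVM` gives the quantum side, and
`integral_deterministicResponse_smul_hiddenState` the side of the model. The normalisation is the
case `X = univ` of the latter, with the trace written as a continuous functional. -/

lemma inner_tensorWith (u u' : HA) (v v' : HB) :
    ⟪tensorWith u v, tensorWith u' v'⟫_ℂ = ⟪u, u'⟫_ℂ * ⟪v, v'⟫_ℂ := by
  change ⟪((u ⊗ₜ[ℂ] v : HA ⊗[ℂ] HB) : HilbertTensor HA HB),
    ((u' ⊗ₜ[ℂ] v' : HA ⊗[ℂ] HB) : HilbertTensor HA HB)⟫_ℂ = _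
  rw [UniformSpace.Completion.inner_coe, TensorProduct.inner_tmul]

lemma adjoint_tensorWith_apply [CompleteSpace HB] (u u' : HA) (v : HB) :
    ContinuousLinearMap.adjoint (tensorWith (HB := HB) u) (tensorWith u' v) = ⟪u, u'⟫_ℂ • v := by
  refine ext_inner_left ℂ fun w => ?_
  rw [ContinuousLinearMap.adjoint_inner_right, inner_tensorWith, inner_smul_right]

lemma ampliation_tensorWith (A : HA →L[ℂ] HA) (u : HA) (v : HB) :
    ampliation A (tensorWith u v) = tensorWith (A u) v := by
  change (A.rTensor HB).completion ((u ⊗ₜ[ℂ] v : HA ⊗[ℂ] HB) : HilbertTensor HA HB) = _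
  rw [ContinuousLinearMap.completion_apply_coe]
  rfl

end Bipartite

/-! ### The assemblage of the noisy NOON state for arbitrary measurements -/

lemma coe_numberBasis : ⇑numberBasis = numberState :=
  HilbertBasis.coe_mkOfOrthogonalEqBot _ _

lemma inner_numberBasis (m n : ℕ) :
    ⟪numberBasis m, numberBasis n⟫_ℂ = if m = n then 1 else 0 :=
  orthonormal_iff_ite.1 numberBasis.orthonormal m n

lemma conj_phase (N : ℕ) (α : ℝ) :
    conj (Complex.exp (Complex.I * N * α)) = Complex.exp (-(Complex.I * N * α)) := by
  rw [← Complex.exp_conj]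
  simp

lemma phase_mul_conj (N : ℕ) (α : ℝ) :
    Complex.exp (Complex.I * N * α) * conj (Complex.exp (Complex.I * N * α)) = 1 := by
  rw [conj_phase, ← Complex.exp_add, add_neg_cancel, Complex.exp_zero]

lemma adjoint_tensorWith_ket (k m n : ℕ) :
    ContinuousLinearMap.adjoint (tensorWith (HB := Mode) (numberBasis k)) (ket m n) =
      (if k = m then 1 else 0 : ℂ) • numberBasis n := by
  rw [ket, adjoint_tensorWith_apply, inner_numberBasis]

lemma adjoint_tensorWith_ampliation_ket (A : Mode →L[ℂ] Mode) (k m n : ℕ) :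
    ContinuousLinearMap.adjoint (tensorWith (HB := Mode) (numberBasis k))
      (ampliation A (ket m n)) = ⟪numberBasis k, A (numberBasis m)⟫_ℂ • numberBasis n := by
  rw [ket, ampliation_tensorWith, adjoint_tensorWith_apply]

/-- Only the slices `k = 0` and `k = N` of the partial trace survive, since `ρ_η` involves no other
number states of Alice's mode. The assumption on `N` makes these two slices distinct. -/
lemma stateAssemblage_noisyNoon {N : ℕ} (hN : 1 ≤ N) (α η : ℝ) {ι 𝒜 : Type}
    (A : ι → Set 𝒜 → (Mode →L[ℂ] Mode)) (x : ι) (X : Set 𝒜) :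
    stateAssemblage numberBasis (noisyNoon N α η) A x X =
      (η / 2 * ⟪numberBasis 0, A x X (numberBasis 0)⟫_ℂ) •
        rankOne ℂ (numberBasis N) (numberBasis N)
      - (η / 2 * Complex.exp (Complex.I * N * α) *
          ⟪numberBasis 0, A x X (numberBasis N)⟫_ℂ) • rankOne ℂ (numberBasis 0) (numberBasis N)
      - (η / 2 * conj (Complex.exp (Complex.I * N * α)) *
          ⟪numberBasis N, A x X (numberBasis 0)⟫_ℂ) • rankOne ℂ (numberBasis N) (numberBasis 0)
      + (η / 2 * ⟪numberBasis N, A x X (numberBasis N)⟫_ℂ +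
          (1 - η) * ⟪numberBasis 0, A x X (numberBasis 0)⟫_ℂ) •
        rankOne ℂ (numberBasis 0) (numberBasis 0) := by
  have h0N : (0 : ℕ) ≠ N := by omega
  have h2 : ((1 / √2 : ℝ) : ℂ) * ((1 / √2 : ℝ) : ℂ) = 1 / 2 := by
    rw [← Complex.ofReal_mul, div_mul_div_comm, Real.mul_self_sqrt (by norm_num)]
    norm_num
  have he := phase_mul_conj N α
  set e := Complex.exp (Complex.I * N * α) with hedef
  set s := ((1 / √2 : ℝ) : ℂ) with hs
  have hsc : conj s = s := Complex.conj_ofReal _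
  -- Slicing keeps each rank one operator of rank one: `A` acts only on the ket, while the bra
  -- carries the factors `δ_{k0}` and `δ_{kN}` that truncate the sum.
  have key : ∀ k, (ContinuousLinearMap.adjoint (tensorWith (HB := Mode) (numberBasis k))).comp
      (((ampliation (A x X)).comp (noisyNoon N α η)).comp (tensorWith (numberBasis k))) =
      (η : ℂ) • rankOne ℂ
        (s • (⟪numberBasis k, A x X (numberBasis 0)⟫_ℂ • numberBasis N -
          e • ⟪numberBasis k, A x X (numberBasis N)⟫_ℂ • numberBasis 0))
        (s • ((if k = 0 then 1 else 0 : ℂ) • numberBasis N -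
          e • (if k = N then 1 else 0 : ℂ) • numberBasis 0)) +
      ((1 - η : ℝ) : ℂ) • rankOne ℂ (⟪numberBasis k, A x X (numberBasis 0)⟫_ℂ • numberBasis 0)
        ((if k = 0 then 1 else 0 : ℂ) • numberBasis 0) := by
    intro k
    simp only [noisyNoon, ContinuousLinearMap.comp_add, ContinuousLinearMap.add_comp,
      ContinuousLinearMap.comp_smul, ContinuousLinearMap.smul_comp,
      InnerProductSpace.comp_rankOne, InnerProductSpace.rankOne_comp]
    simp only [noonVec, map_smul, map_sub, adjoint_tensorWith_ket, adjoint_tensorWith_ampliation_ket, ← hedef, ← hs]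
  rw [stateAssemblage, partialTrace, tsum_congr key, tsum_eq_sum (s := {0, N})]
  · rw [Finset.sum_pair h0N]
    simp only [if_true, if_neg h0N, if_neg h0N.symm, zero_smul, smul_zero, sub_zero, zero_sub,
      one_smul, map_smul, map_sub, map_neg, map_smulₛₗ, hsc, _root_.smul_apply,
      _root_.sub_apply, map_zero, map_mul, add_zero, smul_neg, smul_sub, smul_smul]
    -- The phase cancels only in the coefficient of `|0⟩⟨0|`, where it meets its conjugate;
    -- elsewhere only `(1/√2)² = 1/2` is needed.
    match_scalars
    · linear_combination (η * ⟪numberBasis 0, A x X (numberBasis 0)⟫_ℂ) * h2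
    · linear_combination (-η * e * ⟪numberBasis 0, A x X (numberBasis N)⟫_ℂ) * h2
    · linear_combination (η * e * conj e * ⟪numberBasis N, A x X (numberBasis N)⟫_ℂ) * h2 +
        (η / 2 * ⟪numberBasis N, A x X (numberBasis N)⟫_ℂ) * he
    · linear_combination (-η * conj e * ⟪numberBasis N, A x X (numberBasis 0)⟫_ℂ) * h2
  · intro k hk
    simp only [Finset.mem_insert, Finset.mem_singleton, not_or] at hk
    simp [hk.1, hk.2]

/-! ### Matrix elements of the quadratures -/

/-- The overlap `∫_X ⟨m|q⟩⟨q|n⟩ dq` of two number states over a set of positions. -/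
noncomputable def overlap (m n : ℕ) (X : Set ℝ) : ℂ :=
  ∫ q in X, ((hermiteFun m q * hermiteFun n q : ℝ) : ℂ)

lemma inner_phaseRotation (θ : ℝ) (m : ℕ) (f : Mode) :
    ⟪numberBasis m, phaseRotation θ f⟫_ℂ =
      Complex.exp (Complex.I * m * θ) * ⟪numberBasis m, f⟫_ℂ := by
  rw [← HilbertBasis.repr_apply_apply, ← HilbertBasis.repr_apply_apply]
  change numberBasis.repr (numberBasis.repr.symm (phaseDiagonal θ (numberBasis.repr f))) m = _
  rw [LinearIsometryEquiv.apply_symm_apply]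
  rfl

lemma phaseRotation_numberBasis (θ : ℝ) (n : ℕ) :
    phaseRotation θ (numberBasis n) = Complex.exp (Complex.I * n * θ) • numberBasis n := by
  refine numberBasis.repr.injective ?_
  ext m
  rw [HilbertBasis.repr_apply_apply, HilbertBasis.repr_apply_apply, inner_phaseRotation,
    inner_smul_right, inner_numberBasis]
  split_ifs with h
  · rw [h]
  · simp

lemma inner_positionPVM {X : Set ℝ} (hX : MeasurableSet X) (m n : ℕ) :
    ⟪numberBasis m, positionPVM X (numberBasis n)⟫_ℂ = overlap m n X := by
  have h : positionPVM X = indicatorMul X hX := dif_pos hX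
  rw [h, coe_numberBasis, L2.inner_def, overlap, ← integral_indicator hX]
  apply integral_congr_ae
  filter_upwards [(memLp_hermiteFun m).coeFn_toLp, (memLp_hermiteFun n).coeFn_toLp,
    ((Lp.memLp (numberState n)).indicator hX).coeFn_toLp] with q h1 h2 h3
  have h4 : indicatorMul X hX (numberState n) q =
      ((Lp.memLp (numberState n)).indicator hX).toLp _ q := rfl
  rw [h4, h3]
  by_cases hq : q ∈ X
  · rw [Set.indicator_of_mem hq, Set.indicator_of_mem hq, numberState, numberState, h1, h2]
    simp [mul_comm]
  · rw [Set.indicator_of_notMem hq, Set.indicator_of_notMem hq, inner_zero_right]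

/-- Both rotations are diagonal in the number basis: the outer one gives the phase of the bra index,
the inner one, at angle `-θ`, that of the ket index. -/
lemma inner_quadraturePVM (θ : ℝ) {X : Set ℝ} (hX : MeasurableSet X) (m n : ℕ) :
    ⟪numberBasis m, quadraturePVM θ X (numberBasis n)⟫_ℂ =
      Complex.exp (Complex.I * m * θ) * Complex.exp (-(Complex.I * n * θ)) * overlap m n X := by
  rw [quadraturePVM, ContinuousLinearMap.comp_apply, ContinuousLinearMap.comp_apply,
    inner_phaseRotation, phaseRotation_numberBasis, map_smul, inner_smul_right,
    inner_positionPVM hX, Complex.ofReal_neg, mul_neg, ← mul_assoc]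

/-- This is orthonormality of the Hermite functions, in the form used to integrate out the outcome
of the other setting. -/
lemma overlap_univ (m n : ℕ) : overlap m n Set.univ = if m = n then 1 else 0 := by
  rw [← inner_numberBasis, coe_numberBasis, inner_numberState, overlap, Measure.restrict_univ,
    integral_complex_ofReal]

lemma overlap_comm (m n : ℕ) (X : Set ℝ) : overlap m n X = overlap n m X := by
  simp only [overlap, mul_comm]

lemma integrable_hermiteFun_mul (m n : ℕ) :
    Integrable (fun q => ((hermiteFun m q * hermiteFun n q : ℝ) : ℂ)) := by
  simp only [Complex.ofReal_mul]
  exact (memLp_hermiteFun m).integrable_mul (memLp_hermiteFun n)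

/-- Links the wave functions in the matrix elements with the polynomial factors and the Gaussian
weight in the hidden states. -/
lemma hermiteFun_mul (m n : ℕ) (q : ℝ) : hermiteFun m q * hermiteFun n q =
    hermiteRatio m q * hermiteRatio n q * (Real.exp (-q ^ 2) / √Real.pi) := by
  have h1 : Real.exp (-q ^ 2) = Real.exp (-q ^ 2 / 2) * Real.exp (-q ^ 2 / 2) := by
    rw [← Real.exp_add]; ring_nf
  have h2 : √Real.pi = √(√Real.pi) * √(√Real.pi) := (Real.mul_self_sqrt (by positivity)).symm
  rw [hermiteFun, hermiteFun, h1]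
  -- The first two occurrences of `√π` sit inside `√(√π)` on the left; only the one on the right is
  -- to be split.
  nth_rewrite 3 [h2]
  ring

lemma hermiteRatio_zero (q : ℝ) : hermiteRatio 0 q = 1 := by
  simp [hermiteRatio]

/-! ### Product densities on the plane of hidden variables -/

/-- The function `q ↦ 1_X(q_x) ⟨m|q_x⟩⟨q_x|n⟩ ⟨m'|q_y⟩⟨q_y|n'⟩` on the plane, where `y` is the
index different from `x`. -/
noncomputable def pairDensity (x : Fin 2) (X : Set ℝ) (m n m' n' : ℕ) (q : Fin 2 → ℝ) : ℂ :=
  X.indicator (fun t => ((hermiteFun m t * hermiteFun n t : ℝ) : ℂ)) (q x) *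
    ((hermiteFun m' (q (x + 1)) * hermiteFun n' (q (x + 1)) : ℝ) : ℂ)

/-- Addition in `Fin 2` is modulo 2, so `x + 1` is the other setting and both settings are treated
by one computation. -/
lemma prod_fin_two {R : Type} [CommMonoid R] (f : Fin 2 → R) (x : Fin 2) :
    ∏ z, f z = f x * f (x + 1) := by
  fin_cases x
  · simp
  · simp [mul_comm]

lemma sum_fin_two {R : Type} [AddCommMonoid R] (f : Fin 2 → R) (x : Fin 2) :
    ∑ z, f z = f x + f (x + 1) := by
  fin_cases x
  · simp
  · simp [add_comm]

/-- The form to which Fubini for finite products applies. -/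
lemma pairDensity_eq_prod (x : Fin 2) (X : Set ℝ) (m n m' n' : ℕ) :
    pairDensity x X m n m' n' = fun q => ∏ z, (if z = x then
      X.indicator (fun t => ((hermiteFun m t * hermiteFun n t : ℝ) : ℂ)) else
      fun t => ((hermiteFun m' t * hermiteFun n' t : ℝ) : ℂ)) (q z) := by
  ext q
  have : x + 1 ≠ x := by simp
  rw [prod_fin_two _ x, if_pos rfl, if_neg this, pairDensity]

lemma integrable_pairDensity (x : Fin 2) {X : Set ℝ} (hX : MeasurableSet X) (m n m' n' : ℕ) :
    Integrable (pairDensity x X m n m' n') := by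
  rw [pairDensity_eq_prod]
  refine Integrable.fintype_prod fun z => ?_
  split_ifs
  · exact (integrable_hermiteFun_mul m n).indicator hX
  · exact integrable_hermiteFun_mul m' n'

lemma integral_pairDensity (x : Fin 2) {X : Set ℝ} (hX : MeasurableSet X) (m n m' n' : ℕ) :
    ∫ q, pairDensity x X m n m' n' q = overlap m n X * if m' = n' then 1 else 0 := by
  have : x + 1 ≠ x := by simp
  rw [pairDensity_eq_prod, integral_fintype_prod_volume_eq_prod, prod_fin_two _ x, if_pos rfl,
    if_neg this, integral_indicator hX, ← overlap_univ, overlap, overlap, Measure.restrict_univ]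

/-! ### Expansion and integration of the hidden states -/

lemma conj_phase_neg (N : ℕ) (α : ℝ) :
    conj (Complex.exp (-(Complex.I * N * α))) = Complex.exp (Complex.I * N * α) := by
  rw [← conj_phase, Complex.conj_conj]

/-- Since `h_0 = 1`, the weight is `|⟨0|q_x⟩|² |⟨0|q_y⟩|²`, and each factor `h_N` turns a `0` into
an `N` in the corresponding density. Expanding `|v⟩⟨v|` then leaves six scalar densities, each with
a constant operator, so that operator integrals reduce to scalar ones. -/
lemma deterministicResponse_smul_hiddenState (N : ℕ) (α η : ℝ) (θ : Fin 2 → ℝ) (x : Fin 2)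
    (X : Set ℝ) (q : Fin 2 → ℝ) :
    deterministicResponse x X q • hiddenState N α η θ q =
      pairDensity x X 0 0 0 0 q • ((η / 2 : ℂ) • rankOne ℂ (numberBasis N) (numberBasis N) +
        (1 - 3 * η / 2 : ℂ) • rankOne ℂ (numberBasis 0) (numberBasis 0))
      - pairDensity x X 0 N 0 0 q • ((η / 2 * Complex.exp (Complex.I * N * α) *
          Complex.exp (-(Complex.I * N * θ x))) • rankOne ℂ (numberBasis 0) (numberBasis N) +
        (η / 2 * conj (Complex.exp (Complex.I * N * α)) * Complex.exp (Complex.I * N * θ x)) •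
          rankOne ℂ (numberBasis N) (numberBasis 0))
      - pairDensity x X 0 0 0 N q • ((η / 2 * Complex.exp (Complex.I * N * α) *
          Complex.exp (-(Complex.I * N * θ (x + 1)))) •
            rankOne ℂ (numberBasis 0) (numberBasis N) +
        (η / 2 * conj (Complex.exp (Complex.I * N * α)) *
          Complex.exp (Complex.I * N * θ (x + 1))) • rankOne ℂ (numberBasis N) (numberBasis 0))
      + pairDensity x X N N 0 0 q • (η / 2 : ℂ) • rankOne ℂ (numberBasis 0) (numberBasis 0)
      + pairDensity x X 0 0 N N q • (η / 2 : ℂ) • rankOne ℂ (numberBasis 0) (numberBasis 0)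
      + pairDensity x X 0 N 0 N q • (η / 2 *
          (Complex.exp (-(Complex.I * N * θ x)) * Complex.exp (Complex.I * N * θ (x + 1)) +
            Complex.exp (Complex.I * N * θ x) * Complex.exp (-(Complex.I * N * θ (x + 1))))) •
          rankOne ℂ (numberBasis 0) (numberBasis 0) := by
  by_cases hq : q x ∈ X
  · have he := phase_mul_conj N α
    have hx := phase_mul_conj N (θ x)
    have hy := phase_mul_conj N (θ (x + 1))
    rw [conj_phase] at hx hy
    simp only [deterministicResponse, pairDensity, Set.indicator_of_mem hq, hiddenState,
      hiddenVec, prod_fin_two _ x, sum_fin_two _ x, one_smul, map_sub, map_smul, map_smulₛₗ,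
      map_mul, map_add, conj_phase_neg, Complex.conj_ofReal, _root_.smul_apply,
      _root_.sub_apply, hermiteFun_mul, hermiteRatio_zero, Complex.ofReal_mul,
      one_mul, smul_sub, smul_add, smul_smul]
    set e := Complex.exp (Complex.I * N * α)
    set a := Complex.exp (Complex.I * N * θ x)
    set b := Complex.exp (Complex.I * N * θ (x + 1))
    set a' := Complex.exp (-(Complex.I * N * θ x))
    set b' := Complex.exp (-(Complex.I * N * θ (x + 1)))
    -- With the analytic data replaced by free scalars, comparing coefficients is pure algebra.
    generalize hermiteRatio N (q x) = r
    generalize hermiteRatio N (q (x + 1)) = t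
    generalize Real.exp (-q x ^ 2) / √Real.pi = u
    generalize Real.exp (-q (x + 1) ^ 2) / √Real.pi = v
    push_cast
    match_scalars
    · ring
    · ring
    · ring
    -- The squared modulus of the `|0⟩` component of `v`: the global phase and the two local phases
    -- cancel in the diagonal terms, while the cross term keeps the relative phase of the two
    -- settings.
    · linear_combination (u * v * η / 2 * (a' * r + b' * t) * (a * r + b * t)) * he +
        (u * v * η / 2 * r ^ 2) * hx + (u * v * η / 2 * t ^ 2) * hy
  · simp [deterministicResponse, pairDensity, hq]

/-- Lets integrability and normalisation be read off from the case `X = univ`. -/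
lemma hiddenState_eq_smul (N : ℕ) (α η : ℝ) (θ : Fin 2 → ℝ) (x : Fin 2) (q : Fin 2 → ℝ) :
    hiddenState N α η θ q =
      deterministicResponse x Set.univ q • hiddenState N α η θ q := by
  simp [deterministicResponse]

lemma integrable_deterministicResponse_smul_hiddenState (N : ℕ) (α η : ℝ) (θ : Fin 2 → ℝ)
    (x : Fin 2) {X : Set ℝ} (hX : MeasurableSet X) :
    Integrable fun q => deterministicResponse x X q • hiddenState N α η θ q := by
  simp only [deterministicResponse_smul_hiddenState]
  have h := fun m n m' n' (T : Mode →L[ℂ] Mode) =>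
    (integrable_pairDensity x hX m n m' n').smul_const T
  exact (((((h _ _ _ _ _).sub (h _ _ _ _ _)).sub (h _ _ _ _ _)).add (h _ _ _ _ _)).add
    (h _ _ _ _ _)).add (h _ _ _ _ _)

lemma integrable_hiddenState (N : ℕ) (α η : ℝ) (θ : Fin 2 → ℝ) :
    Integrable (hiddenState N α η θ) := by
  rw [funext (hiddenState_eq_smul N α η θ 0)]
  exact integrable_deterministicResponse_smul_hiddenState N α η θ 0 .univ

/-- Terms with a single `h_N(q_y)` vanish by orthogonality, including the interference between the
settings. The term with `h_N(q_y)²` contributes `η/2`, and `1 - 3η/2 + η/2 = 1 - η`. -/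
lemma integral_deterministicResponse_smul_hiddenState {N : ℕ} (hN : 1 ≤ N) (α η : ℝ)
    (θ : Fin 2 → ℝ) (x : Fin 2) {X : Set ℝ} (hX : MeasurableSet X) :
    ∫ q, deterministicResponse x X q • hiddenState N α η θ q =
      (η / 2 * overlap 0 0 X) • rankOne ℂ (numberBasis N) (numberBasis N)
      - (η / 2 * Complex.exp (Complex.I * N * α) *
          (Complex.exp (-(Complex.I * N * θ x)) * overlap 0 N X)) •
        rankOne ℂ (numberBasis 0) (numberBasis N)
      - (η / 2 * conj (Complex.exp (Complex.I * N * α)) *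
          (Complex.exp (Complex.I * N * θ x) * overlap N 0 X)) •
        rankOne ℂ (numberBasis N) (numberBasis 0)
      + (η / 2 * overlap N N X + (1 - η) * overlap 0 0 X) •
        rankOne ℂ (numberBasis 0) (numberBasis 0) := by
  have h := fun m n m' n' (T : Mode →L[ℂ] Mode) =>
    (integrable_pairDensity x hX m n m' n').smul_const T
  have h0N : 0 ≠ N := by omega
  simp only [deterministicResponse_smul_hiddenState]
  rw [integral_add (by fun_prop) (by fun_prop), integral_add (by fun_prop) (by fun_prop),
    integral_add (by fun_prop) (by fun_prop), integral_sub (by fun_prop) (by fun_prop),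
    integral_sub (by fun_prop) (by fun_prop)]
  simp only [integral_smul_const, integral_pairDensity x hX, if_true, if_neg h0N, mul_one,
    mul_zero, zero_smul, sub_zero, add_zero, overlap_comm N 0]
  module

lemma stateAssemblage_noisyNoon_quadraturePVM {N : ℕ} (hN : 1 ≤ N) (α η : ℝ) (θ : Fin 2 → ℝ)
    (x : Fin 2) {X : Set ℝ} (hX : MeasurableSet X) :
    stateAssemblage numberBasis (noisyNoon N α η) (fun x => quadraturePVM (θ x)) x X =
      ∫ q, deterministicResponse x X q • hiddenState N α η θ q := by
  rw [stateAssemblage_noisyNoon hN, integral_deterministicResponse_smul_hiddenState hN α η θ x hX]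
  have hx := phase_mul_conj N (θ x)
  rw [conj_phase] at hx
  simp only [inner_quadraturePVM _ hX, Nat.cast_zero, mul_zero, zero_mul, neg_zero,
    Complex.exp_zero, one_mul, mul_one, hx]

/-! ### Positivity and normalisation -/

/-- The trace functional restricted to the span of `|0⟩` and `|N⟩`. -/
noncomputable def traceZeroN (N : ℕ) : (Mode →L[ℂ] Mode) →L[ℂ] ℂ :=
  (innerSL ℂ (numberBasis 0)).comp (ContinuousLinearMap.apply ℂ Mode (numberBasis 0)) +
    (innerSL ℂ (numberBasis N)).comp (ContinuousLinearMap.apply ℂ Mode (numberBasis N))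

lemma traceZeroN_apply (N : ℕ) (T : Mode →L[ℂ] Mode) : traceZeroN N T =
    ⟪numberBasis 0, T (numberBasis 0)⟫_ℂ + ⟪numberBasis N, T (numberBasis N)⟫_ℂ := rfl

/-- The bound `η ≤ 2/3` enters here, as nonnegativity of the coefficient `1 - 3η/2`; every later use
of it passes through this positivity. -/
lemma isPositive_hiddenState (N : ℕ) (α : ℝ) {η : ℝ} (h0 : 0 ≤ η) (h1 : η ≤ 2 / 3)
    (θ q : Fin 2 → ℝ) : (hiddenState N α η θ q).IsPositive := by
  have hr : ∀ {c : ℝ}, 0 ≤ c → (0 : ℂ) ≤ (c : ℂ) := fun h => Complex.zero_le_real.2 h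
  refine ContinuousLinearMap.IsPositive.smul_of_nonneg ?_
    (hr (Finset.prod_nonneg fun x _ => by positivity))
  exact ((isPositive_rankOne_self _).smul_of_nonneg (hr (by linarith))).add
    ((isPositive_rankOne_self _).smul_of_nonneg (hr (by linarith)))

/-- The hidden state annihilates every other number state. The extended nonnegative trace thus
becomes a continuous linear functional, which commutes with the Bochner integral. -/
lemma posTrace_hiddenState {N : ℕ} (hN : 1 ≤ N) (α : ℝ) {η : ℝ} (h0 : 0 ≤ η) (h1 : η ≤ 2 / 3)
    (θ q : Fin 2 → ℝ) : posTrace numberBasis (hiddenState N α η θ q) =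
      ENNReal.ofReal (traceZeroN N (hiddenState N α η θ q)).re := by
  have h0N : 0 ≠ N := by omega
  have hp := isPositive_hiddenState N α h0 h1 θ q
  rw [posTrace, tsum_eq_sum (s := {0, N}), Finset.sum_pair h0N, traceZeroN_apply, Complex.add_re]
  · exact (ENNReal.ofReal_add (hp.re_inner_nonneg_right _) (hp.re_inner_nonneg_right _)).symm
  intro k hk
  simp only [Finset.mem_insert, Finset.mem_singleton, not_or] at hk
  have hv : ⟪hiddenVec N α θ q, numberBasis k⟫_ℂ = 0 := by
    rw [hiddenVec, inner_sub_left, inner_smul_left, inner_numberBasis, inner_numberBasis,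
      if_neg (Ne.symm hk.1), if_neg (Ne.symm hk.2)]
    simp
  simp [hiddenState, hv, inner_numberBasis, Ne.symm hk.1]

/-- The diagonal of the integrated operator at `X = univ` sums to `η/2 + (η/2 + 1 - η) = 1`. -/
lemma integral_traceZeroN_hiddenState {N : ℕ} (hN : 1 ≤ N) (α η : ℝ) (θ : Fin 2 → ℝ) :
    ∫ q, traceZeroN N (hiddenState N α η θ q) = 1 := by
  have h0N : 0 ≠ N := by omega
  rw [ContinuousLinearMap.integral_comp_comm _ (integrable_hiddenState N α η θ),
    funext (hiddenState_eq_smul N α η θ 0),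
    integral_deterministicResponse_smul_hiddenState hN α η θ 0 .univ]
  simp only [overlap_univ, if_true, if_neg h0N, if_neg h0N.symm, traceZeroN_apply,
    _root_.add_apply, _root_.sub_apply, _root_.smul_apply, rankOne_apply, inner_add_right,
    inner_sub_right, inner_smul_right, inner_numberBasis]
  ring

lemma lintegral_posTrace_hiddenState {N : ℕ} (hN : 1 ≤ N) (α : ℝ) {η : ℝ} (h0 : 0 ≤ η)
    (h1 : η ≤ 2 / 3) (θ : Fin 2 → ℝ) :
    ∫⁻ q, posTrace numberBasis (hiddenState N α η θ q) = 1 := by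
  have hi : Integrable fun q => traceZeroN N (hiddenState N α η θ q) :=
    (traceZeroN N).integrable_comp (integrable_hiddenState N α η θ)
  have hre : ∫ q, (traceZeroN N (hiddenState N α η θ q)).re = 1 := by
    have := integral_re hi
    simp only [RCLike.re_to_complex] at this
    rw [this, integral_traceZeroN_hiddenState hN, Complex.one_re]
  simp only [posTrace_hiddenState hN α h0 h1]
  have hnn : ∀ q, 0 ≤ (traceZeroN N (hiddenState N α η θ q)).re := fun q => by
    have hp := isPositive_hiddenState N α h0 h1 θ q
    exact add_nonneg (hp.re_inner_nonneg_right _) (hp.re_inner_nonneg_right _)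
  refine (ofReal_integral_eq_lintegral_ofReal hi.re (.of_forall hnn)).symm.trans ?_
  simp only [RCLike.re_to_complex, hre, ENNReal.ofReal_one]

/-! ### The response kernel and the complete model -/

lemma isWeakMarkovKernel_deterministicResponse (x : Fin 2) :
    IsWeakMarkovKernel (volume : Measure (Fin 2 → ℝ)) (deterministicResponse x) where
  measurable X hX := (measurable_const.indicator hX).comp (measurable_pi_apply x)
  mem_Icc X _ q := by
    by_cases hq : q x ∈ X <;> simp [deterministicResponse, hq]
  normalised := .of_forall fun q => by simp [deterministicResponse]
  additive X _ hd := .of_forall fun q => by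
    simp only [deterministicResponse]
    -- The response is the point mass at `q_x`: by disjointness at most one set of the sequence
    -- contains that point, so additivity holds for every `q`, with no exceptional set.
    by_cases hq : q x ∈ ⋃ i, X i
    · obtain ⟨i, hi⟩ := Set.mem_iUnion.1 hq
      rw [Set.indicator_of_mem hq]
      convert hasSum_single i fun j hj => ?_
      · rw [Set.indicator_of_mem hi]
      · exact Set.indicator_of_notMem (fun hqj => Set.disjoint_left.1 (hd hj) hqj hi) _
    · rw [Set.indicator_of_notMem hq]
      convert hasSum_zero with i
      exact Set.indicator_of_notMem (fun hi => hq (Set.mem_iUnion.2 ⟨i, hi⟩)) _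

lemma isLHSModel_hiddenState {N : ℕ} (hN : 1 ≤ N) (α : ℝ) {η : ℝ} (h0 : 0 ≤ η) (h1 : η ≤ 2 / 3)
    (θ : Fin 2 → ℝ) :
    IsLHSModel numberBasis
      (stateAssemblage numberBasis (noisyNoon N α η) (fun x => quadraturePVM (θ x)))
      (volume : Measure (Fin 2 → ℝ)) (hiddenState N α η θ) deterministicResponse where
  positive := isPositive_hiddenState N α h0 h1 θ
  traceClass q := by
    rw [posTrace_hiddenState hN α h0 h1]
    exact ENNReal.ofReal_lt_top
  integrable := integrable_hiddenState N α η θ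
  normalised := lintegral_posTrace_hiddenState hN α h0 h1 θ
  kernel := isWeakMarkovKernel_deterministicResponse
  decomposition x _ hX := stateAssemblage_noisyNoon_quadraturePVM hN α η θ x hX

lemma noonUnsteerable {N : ℕ} (hN : 1 ≤ N) (α : ℝ) {η : ℝ} (h0 : 0 ≤ η) (h1 : η ≤ 2 / 3)
    (θ : Fin 2 → ℝ) : NoonUnsteerable N α η θ :=
  ⟨Fin 2 → ℝ, inferInstance, volume, inferInstance, _, _, isLHSModel_hiddenState hN α h0 h1 θ⟩

end NoonSteering

theorem mainTheorem9 (N : ℕ) (hN : 1 ≤ N) (α : ℝ) (θ : Fin 2 → ℝ) :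
    (∀ η : ℝ, 0 ≤ η → η ≤ 2 / 3 →
      NoonSteering.NoonUnsteerable N α η θ ∧
      NoonSteering.IsLHSModel NoonSteering.numberBasis
        (NoonSteering.stateAssemblage NoonSteering.numberBasis (NoonSteering.noisyNoon N α η)
          (fun x => NoonSteering.quadraturePVM (θ x)))
        (volume : Measure (Fin 2 → ℝ)) (NoonSteering.hiddenState N α η θ)
        NoonSteering.deterministicResponse) ∧
    2 / 3 ≤ NoonSteering.steeringThreshold N α θ := by
  refine ⟨fun η h0 h1 => ⟨NoonSteering.noonUnsteerable hN α h0 h1 θ,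
    NoonSteering.isLHSModel_hiddenState hN α h0 h1 θ⟩, ?_⟩
  -- The supremum in `ℝ` needs an upper bound, here `1`; the endpoint `η = 2/3` itself belongs to
  -- the set.
  exact le_csSup ⟨1, fun _ h => h.1.2⟩ ⟨⟨by norm_num, by norm_num⟩,
    NoonSteering.noonUnsteerable hN α (by norm_num) le_rfl θ⟩
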